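/- **Theorem (Extended delta method).** Let $(\Omega,\mathcal A,\mathbb P)$ be a probability space. For an arbitrary map $T:\Omega\to\overline{\mathbb R}$ let $E^*[T]=\inf\{E[U]:U\ge T,\ U:\Omega\to\overline{\mathbb R}\text{ measurable and }E[U]\text{ exists}\}$, and for $B\subset\Omega$ let $\mathbb P^*(B)=\inf\{\mathbb P(A):A\supset B,\ A\in\mathcal A\}$. For arbitrary maps $Z_n$ from $\Omega$ into a metrizable space $\mathbb S$ and a Borel measurable random element $Z$ of $\mathbb S$, possibly defined on another probability space, write $Z_n\leadsto Z$ if $E^*[f(Z_n)]\to E[f(Z)]$ for every bounded continuous $f:\mathbb S\to\mathbb R$ (Hoffmann-Jørgensen weak convergence). Here Borel measurability of the limit is understood up to a null set. Arbitrary maps $Z_n$ from $\Omega$ into a metrizable topological vector space converge to zero in outer probability if $\mathbb P^*(Z_n\notin U)\to0$ for every neighbourhood $U$ of $0$. A random element is called separable if it lies almost surely in a separable Borel set. Let $\mathbb D$ and $\mathbb E$ be (real) metrizable topological vector spaces, and let $r_n$ be nonzero real constants with $r_n\to\infty$. Let $\mathbb D_{\mathcal F},\mathbb D_0\subset\mathbb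 D$, let $\mathcal F:\mathbb D_{\mathcal F}\to\mathbb E$ and $\mathcal F'_\phi:\mathbb D_0\to\mathbb E$ be maps, and let $\hat\phi_n,X_n:\Omega\to\mathbb D_{\mathcal F}$, $n\ge1$, be arbitrary (not necessarily measurable) maps. Suppose that $r_n(X_n-\hat\phi_n)\leadsto X$, where $X$ takes its values in $\mathbb D_0$. (i) Suppose that for every $\varepsilon>0$ there is a measurable set $A\subset\Omega$ with $\mathbb P(A)\ge1-\varepsilon$ such that $$r_n\bigl(\mathcal F(\hat\phi_n(\omega)+r_n^{-1}h_n)-\mathcal F(\hat\phi_n(\omega))\bigr)\to\mathcal F'_\phi(h)\quad\text{uniformly in }\omega\in A$$ for every sequence $\{h_n\}\subset\mathbb D$ with $h_n\to h\in\mathbb D_0$ and $\hat\phi_n(\omega)+r_n^{-1}h_n\in\mathbb D_{\mathcal F}$ for all $n$ and all $\omega\in\Omega$. Suppose also that $X_n(\omega)-\hat\phi_n(\omega)+\hat\phi_n(\omega')\in\mathbb D_{\mathcal F}$ for all $n$ and all $\omega,\omega'\in\Omega$, and that $X$ is separable. Then $$r_n\bigl(\mathcal F(X_n)-\mathcal F(\hat\phi_n)\bigr)\leadsto\mathcal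 F'_\phi(X).$$ If, moreover, $\mathcal F'_\phi$ is defined and continuous on all of $\mathbb D$, then $r_n(\mathcal F(X_n)-\mathcal F(\hat\phi_n))-\mathcal F'_\phi(r_n(X_n-\hat\phi_n))$ converges to zero in outer probability. (ii) Suppose that $\mathcal F'_\phi$ is continuous on $\mathbb D_0$ and that for every $\varepsilon>0$ there is a measurable set $A\subset\Omega$ with $\mathbb P(A)\ge1-\varepsilon$ such that $$r_{n_m}\bigl(\mathcal F(\hat\phi_{n_m}(\omega_{n_m})+r_{n_m}^{-1}h_{n_m})-\mathcal F(\hat\phi_{n_m}(\omega_{n_m}))\bigr)\to\mathcal F'_\phi(h)\quad(m\to\infty)$$ for every subsequence $n_1<n_2<\cdots$, all points $\omega_{n_m}\in A$ and all $h_{n_m}\in\mathbb D$ with $h_{n_m}\to h\in\mathbb D_0$ and $\hat\phi_{n_m}(\omega_{n_m})+r_{n_m}^{-1}h_{n_m}\in\mathbb D_{\mathcal F}$ for all $m$. Then both conclusions of (i) hold, the second again if $\mathcal F'_\phi$ is defined and continuous on all of $\mathbb D$. (Neither separability of $X$ nor the condition on $X_n(\omega)-\hat\phi_n(\omega)+\hat\phi_n(\omega')$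 is needed here.) -/

import Mathlib

open MeasureTheory Filter Topology

noncomputable section

namespace ExtendedDelta

/-- The expectation of an extended-real-valued map `U` exists: `U` is measurable and its positive
part or its negative part has a finite integral. -/
def HasExpectation {Ω : Type*} [MeasurableSpace Ω] (P : Measure Ω) (U : Ω → EReal) : Prop :=
  Measurable U ∧ (∫⁻ ω, (U ω).toENNReal ∂P ≠ ⊤ ∨ ∫⁻ ω, (-U ω).toENNReal ∂P ≠ ⊤)

/-- The expectation `E[U] = E[U⁺] - E[U⁻]` of an extended-real-valued map (meaningful if
`HasExpectation P U`). -/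
def expectation {Ω : Type*} [MeasurableSpace Ω] (P : Measure Ω) (U : Ω → EReal) : EReal :=
  ((∫⁻ ω, (U ω).toENNReal ∂P : ENNReal) : EReal) - ((∫⁻ ω, (-U ω).toENNReal ∂P : ENNReal) : EReal)

/-- The outer expectation `E*[T] = inf {E[U] : U ≥ T, U measurable, E[U] exists}` of an arbitrary
map `T`. -/
def outerExpectation {Ω : Type*} [MeasurableSpace Ω] (P : Measure Ω) (T : Ω → EReal) : EReal :=
  sInf {c | ∃ U : Ω → EReal, (∀ ω, T ω ≤ U ω) ∧ HasExpectation P U ∧ c = expectation P U}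

/-- Hoffmann-Jørgensen weak convergence `X n ⇝ Y`: the maps `X n` are arbitrary, the limit `Y`
(possibly defined on another probability space) is Borel measurable up to a null set, and
`E*[f (X n)] → E[f Y]` for every bounded continuous real function `f`. -/
def WeakConv {Ω Ω' S : Type*} [MeasurableSpace Ω] [MeasurableSpace Ω'] [TopologicalSpace S]
    [MeasurableSpace S] (P : Measure Ω) (P' : Measure Ω') (X : ℕ → Ω → S) (Y : Ω' → S) : Prop :=
  AEMeasurable Y P' ∧
    ∀ f : BoundedContinuousFunction S ℝ,
      Tendsto (fun n => outerExpectation P (fun ω => ((f (X n ω) : ℝ) : EReal))) atTop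
        (𝓝 ((∫ ω, f (Y ω) ∂P' : ℝ) : EReal))

/-- Convergence of arbitrary maps to the constant `0` in outer probability. The value of a measure
at an arbitrary set `B` is `inf {P A : A ⊇ B measurable}`, that is, the outer probability of `B`.
For a metric `d` that induces the topology, the balls around `0` form a basis of neighbourhoods,
so that this says `P*(d (Z n) 0 > ε) → 0` for every `ε > 0`. -/
def TendstoZeroInOuterProb {Ω S : Type*} [MeasurableSpace Ω] [TopologicalSpace S] [Zero S]
    (P : Measure Ω) (Z : ℕ → Ω → S) : Prop :=
  ∀ U ∈ 𝓝 (0 : S), Tendsto (fun n => P {ω | Z n ω ∉ U}) atTop (𝓝 0)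

/-- `Y` is separable: it lies almost surely in a separable Borel set. -/
def IsSeparableElement {Ω' S : Type*} [MeasurableSpace Ω'] [TopologicalSpace S]
    [MeasurableSpace S] (P' : Measure Ω') (Y : Ω' → S) : Prop :=
  ∃ C : Set S, TopologicalSpace.IsSeparable C ∧ MeasurableSet C ∧ ∀ᵐ ω ∂P', Y ω ∈ C

section

variable {Ω D E : Type*} [MeasurableSpace Ω]
  [AddCommGroup D] [Module ℝ D] [TopologicalSpace D]
  [AddCommGroup E] [Module ℝ E] [TopologicalSpace E]

/-- The random difference quotient `r n • (F (φ n ω + (r n)⁻¹ • h) - F (φ n ω))`. -/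
def diffQuot (F : D → E) (r : ℕ → ℝ) (φ : ℕ → Ω → D) (n : ℕ) (ω : Ω) (h : D) : E :=
  r n • (F (φ n ω + (r n)⁻¹ • h) - F (φ n ω))

/-- The uniform condition: for every `ε > 0` there is a measurable set `A` of probability at least
`1 - ε` such that, for all `h n → h₀ ∈ D0` with `φ n ω + (r n)⁻¹ • h n ∈ DF` for all `n` and all
`ω`, the difference quotients at `h n` converge to `F' h₀` uniformly on `A`. Only the values of `F`
on `DF` and those of `F'` on `D0` matter. -/
def UniformCondition (P : Measure Ω) (F : D → E) (DF D0 : Set D) (r : ℕ → ℝ) (φ : ℕ → Ω → D)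
    (F' : D → E) : Prop :=
  ∀ ε : ℝ, 0 < ε → ∃ A : Set Ω, MeasurableSet A ∧ 1 - ε ≤ P.real A ∧
    ∀ (h : ℕ → D) (h₀ : D), (∀ n ω, φ n ω + (r n)⁻¹ • h n ∈ DF) → h₀ ∈ D0 →
      Tendsto h atTop (𝓝 h₀) →
        ∀ V ∈ 𝓝 (F' h₀), ∀ᶠ n in atTop, ∀ ω ∈ A, diffQuot F r φ n ω (h n) ∈ V

/-- The subsequence condition: for every `ε > 0` there is a measurable set `A` of probability at
least `1 - ε` such that, along every subsequence `k m`, for all points `w m ∈ A` and all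
`h m → h₀ ∈ D0` with `φ (k m) (w m) + (r (k m))⁻¹ • h m ∈ DF` for all `m`, the difference
quotients at `h m` and `w m` converge to `F' h₀`. -/
def SubseqCondition (P : Measure Ω) (F : D → E) (DF D0 : Set D) (r : ℕ → ℝ) (φ : ℕ → Ω → D)
    (F' : D → E) : Prop :=
  ∀ ε : ℝ, 0 < ε → ∃ A : Set Ω, MeasurableSet A ∧ 1 - ε ≤ P.real A ∧
    ∀ (k : ℕ → ℕ) (w : ℕ → Ω) (h : ℕ → D) (h₀ : D), StrictMono k → (∀ m, w m ∈ A) →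
      (∀ m, φ (k m) (w m) + (r (k m))⁻¹ • h m ∈ DF) → h₀ ∈ D0 → Tendsto h atTop (𝓝 h₀) →
        Tendsto (fun m => diffQuot F r φ (k m) (w m) (h m)) atTop (𝓝 (F' h₀))

end

end ExtendedDelta

end

/-!
Put `Z n = r n • (X n - φ n)`. Then `r n • (F (X n) - F (φ n))` is the random difference quotient
`g n ω = diffQuot F r φ n ω` evaluated at `Z n ω`, so that the delta method is an extended
continuous mapping theorem for the random maps `g n ω`. Everything goes through the closed-set
inequality `limsup P* (Z n ∈ K) ≤ P' (Y ∈ K)`, which is equivalent to weak convergence also for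
arbitrary maps and a Borel limit (`WeakConv.limsup_measure_le`, `weakConv_of_limsup_measure_le`).

The core is `SubseqContinuousConv.limsup_measure_le`. Let `A` be a set of probability at least
`1 - ε` on which the `g n ω` converge continuously to `F'`, along all subsequences. For closed `K`
let `L j` be the closure of the set of all `h` with `g n ω h ∈ K` for some `n ≥ j` and `ω ∈ A`. Then
`{g n ω (Z n ω) ∈ K} ∩ A ⊆ {Z n ∈ L j}` for `n ≥ j`, so the closed-set inequality for `Z n` bounds
the limit superior by `P' (Y ∈ L j) + ε`. As `j → ∞` this tends to `P' (Y ∈ ⋂ j, L j) + ε`, and the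
points of `⋂ j, L j` at which the convergence holds are sent to `K` by `F'`. Convergence in outer
probability is the same inequality for `g n ω h - F' h`, which converges continuously to `0` if `F'`
is continuous (`SubseqContinuousConv.weakConv_and_tendstoZero`).

The subsequence condition is the hypothesis of this core verbatim. Under the uniform condition the
`Z n` take their values in the directions `S n` admissible at every `ω`, and a sequence given along
a subsequence can be completed to a full one if its limit lies in the lower limit of the sets `S n`
(`UniformCondition.subseqContinuousConv`). Separability of `Y` is used once, to see that `Y` almost
surely lies in this lower limit (`ae_mem_lowerLimit`). On it `F'` is automatically continuous
(`SubseqContinuousConv.continuousOn`), which makes `F' ∘ Y` measurable up to a null set.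
-/

namespace ExtendedDelta

open scoped ENNReal NNReal

/-! ### Outer expectations -/

section OuterExpectation

variable {Ω : Type*} [MeasurableSpace Ω] {P : Measure Ω}

lemma expectation_mono {U V : Ω → EReal} (h : ∀ ω, U ω ≤ V ω) :
    expectation P U ≤ expectation P V := by
  unfold expectation
  refine EReal.sub_le_sub ?_ ?_
  · exact EReal.coe_ennreal_le_coe_ennreal_iff.2
      (lintegral_mono fun ω => EReal.toENNReal_le_toENNReal (h ω))
  · exact EReal.coe_ennreal_le_coe_ennreal_iff.2
      (lintegral_mono fun ω => EReal.toENNReal_le_toENNReal (EReal.neg_le_neg_iff.2 (h ω)))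

lemma expectation_coe {u : Ω → ℝ} (hi : Integrable u P) :
    expectation P (fun ω => (u ω : EReal)) = ((∫ ω, u ω ∂P : ℝ) : EReal) := by
  have h1 : ∫⁻ ω, ENNReal.ofReal (u ω) ∂P ≠ ∞ := hi.lintegral_lt_top.ne
  have h2 : ∫⁻ ω, ENNReal.ofReal (-u ω) ∂P ≠ ∞ := hi.neg.lintegral_lt_top.ne
  rw [integral_eq_lintegral_pos_part_sub_lintegral_neg_part hi, EReal.coe_sub,
    EReal.coe_ennreal_toReal h1, EReal.coe_ennreal_toReal h2]
  rfl

lemma hasExpectation_coe {u : Ω → ℝ} (hu : Measurable u) (hi : Integrable u P) :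
    HasExpectation P (fun ω => (u ω : EReal)) :=
  ⟨hu.coe_real_ereal, Or.inl hi.lintegral_lt_top.ne⟩

lemma outerExpectation_le_integral {T : Ω → EReal} {u : Ω → ℝ} (hu : Measurable u)
    (hi : Integrable u P) (h : ∀ ω, T ω ≤ u ω) :
    outerExpectation P T ≤ ((∫ ω, u ω ∂P : ℝ) : EReal) :=
  sInf_le ⟨fun ω => (u ω : EReal), h, hasExpectation_coe hu hi, (expectation_coe hi).symm⟩

lemma integral_le_outerExpectation {T : Ω → EReal} {u : Ω → ℝ}
    (hi : Integrable u P) (h : ∀ ω, (u ω : EReal) ≤ T ω) :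
    ((∫ ω, u ω ∂P : ℝ) : EReal) ≤ outerExpectation P T := by
  refine le_sInf ?_
  rintro c ⟨U, hU, -, rfl⟩
  rw [← expectation_coe hi]
  exact expectation_mono fun ω => (h ω).trans (hU ω)

/-- Markov's inequality at level `1`, for an arbitrary map and its outer expectation. -/
lemma measure_le_outerExpectation {T : Ω → EReal} {B : Set Ω} (h0 : ∀ ω, 0 ≤ T ω)
    (h1 : ∀ ω ∈ B, 1 ≤ T ω) : (P B : EReal) ≤ outerExpectation P T := by
  refine le_sInf ?_
  rintro c ⟨U, hU, hE, rfl⟩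
  have hneg : ∫⁻ ω, (-U ω).toENNReal ∂P = 0 := by
    have : ∀ ω, (-U ω).toENNReal = 0 := fun ω =>
      EReal.toENNReal_of_nonpos (EReal.neg_le_zero.2 ((h0 ω).trans (hU ω)))
    simp [this]
  rw [expectation, hneg, EReal.coe_ennreal_zero, sub_zero, EReal.coe_ennreal_le_coe_ennreal_iff]
  calc P B ≤ P {ω | 1 ≤ (U ω).toENNReal} := measure_mono fun ω hω => by
        have := EReal.toENNReal_le_toENNReal ((h1 ω hω).trans (hU ω))
        rwa [← EReal.coe_ennreal_one, EReal.toENNReal_coe] at this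
    _ ≤ ∫⁻ ω, (U ω).toENNReal ∂P := by
        simpa using mul_meas_ge_le_lintegral (μ := P) hE.1.ereal_toENNReal 1

end OuterExpectation

/-! ### The portmanteau theorem for arbitrary maps -/

section Portmanteau

variable {Ω Ω' S : Type*} [MeasurableSpace Ω] [MeasurableSpace Ω'] [TopologicalSpace S]
  [MeasurableSpace S] [BorelSpace S] {P : Measure Ω}
  {P' : Measure Ω'} [IsProbabilityMeasure P'] {Z : ℕ → Ω → S} {Y : Ω' → S}

/-- The closed-set half of the portmanteau theorem for arbitrary maps. -/
lemma WeakConv.limsup_measure_le [HasOuterApproxClosed S] (h : WeakConv P P' Z Y) {K : Set S}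
    (hK : IsClosed K) : limsup (fun n => P {ω | Z n ω ∈ K}) atTop ≤ P' {ω | Y ω ∈ K} := by
  obtain ⟨hY, h⟩ := h
  refine le_of_forall_gt fun c hc => ?_
  have hmap : P' {ω | Y ω ∈ K} = P'.map Y K := (Measure.map_apply_of_aemeasurable hY
    hK.measurableSet).symm
  have : IsProbabilityMeasure (P'.map Y) := Measure.isProbabilityMeasure_map hY
  rw [hmap] at hc
  obtain ⟨c', hc1, hc2⟩ := exists_between hc
  obtain ⟨j, hj⟩ := ((HasOuterApproxClosed.tendsto_lintegral_apprSeq hK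
    (P'.map Y)).eventually_lt_const hc1).exists
  -- the `ℝ≥0`-valued approximation of the indicator of `K`, as a real-valued function
  let f : BoundedContinuousFunction S ℝ :=
    BoundedContinuousFunction.comp _ (NNReal.isometry_coe.lipschitz) (hK.apprSeq j)
  have hf : ∀ x, f x = (hK.apprSeq j x : ℝ) := fun _ => rfl
  have hint : ((∫ ω, f (Y ω) ∂P' : ℝ) : EReal) < (c' : EReal) := by
    have h1 : ((∫ ω, f (Y ω) ∂P' : ℝ) : EReal)
        = ((∫⁻ x, (hK.apprSeq j x : ℝ≥0∞) ∂(P'.map Y) : ℝ≥0∞) : EReal) := by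
      rw [← integral_map (f := fun x => f x) hY f.continuous.measurable.aestronglyMeasurable,
        integral_eq_lintegral_of_nonneg_ae (ae_of_all _ fun x => by simp [hf])
          f.continuous.measurable.aestronglyMeasurable]
      have : ∀ x, ENNReal.ofReal (f x) = (hK.apprSeq j x : ℝ≥0∞) := fun x => by simp [hf]
      simp_rw [this]
      exact EReal.coe_ennreal_toReal (ne_top_of_lt hj)
    rw [h1]
    exact EReal.coe_ennreal_lt_coe_ennreal_iff.2 hj
  refine lt_of_le_of_lt (limsup_le_of_le (a := c') (by isBoundedDefault) ?_) hc2
  filter_upwards [(h f).eventually_lt_const hint] with n hn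
  refine EReal.coe_ennreal_le_coe_ennreal_iff.1 (le_trans ?_ hn.le)
  refine measure_le_outerExpectation (fun ω => ?_) fun ω hω => ?_
  · simp [hf]
  · have : hK.apprSeq j (Z n ω) = 1 := HasOuterApproxClosed.apprSeq_apply_eq_one hK j hω
    simp [hf, this]

/-- Counting the levels `1, …, N` below `s` recovers `s` up to an error of at most `1`. -/
lemma sum_indicator_levels {N : ℕ} {s : ℝ} (h0 : 0 ≤ s) (hN : s ≤ N) :
    (∑ i ∈ Finset.range N, if (i + 1 : ℝ) ≤ s then (1 : ℝ) else 0) ≤ s ∧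
      s - 1 ≤ ∑ i ∈ Finset.range N, if (i + 1 : ℝ) ≤ s then (1 : ℝ) else 0 := by
  have : (∑ i ∈ Finset.range N, if (i + 1 : ℝ) ≤ s then (1 : ℝ) else 0) = (⌊s⌋₊ : ℝ) := by
    rw [Finset.sum_ite, Finset.sum_const_zero, add_zero, Finset.sum_const, nsmul_eq_mul, mul_one]
    congr 1
    have : (Finset.range N).filter (fun i : ℕ => (i + 1 : ℝ) ≤ s) = Finset.range ⌊s⌋₊ := by
      ext i
      have h1 : (i + 1 : ℝ) ≤ s ↔ i + 1 ≤ ⌊s⌋₊ := by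
        rw [Nat.le_floor_iff h0]; push_cast; rfl
      have h2 : ⌊s⌋₊ ≤ N := Nat.floor_le_of_le hN
      simp only [Finset.mem_filter, Finset.mem_range, h1]
      omega
    rw [this, Finset.card_range]
  rw [this]
  exact ⟨Nat.floor_le h0, by linarith [Nat.lt_floor_add_one s]⟩

/-- If the closed-set inequality of the portmanteau theorem holds, then a bounded continuous
function of `Z n` has measurable majorants whose integrals are asymptotically at most
`∫ f (Y)`: a step function with equidistant levels, built from measurable hulls of the sets
`{f (Z n) ≥ level}`. -/
lemma eventually_exists_majorant [IsProbabilityMeasure P] (hY : AEMeasurable Y P')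
    (h : ∀ K : Set S, IsClosed K →
      limsup (fun n => P {ω | Z n ω ∈ K}) atTop ≤ P' {ω | Y ω ∈ K})
    (f : BoundedContinuousFunction S ℝ) {δ : ℝ} (hδ : 0 < δ) :
    ∀ᶠ n in atTop, ∃ u : Ω → ℝ, Measurable u ∧ Integrable u P ∧ (∀ ω, f (Z n ω) ≤ u ω) ∧
      ∫ ω, u ω ∂P ≤ ∫ ω, f (Y ω) ∂P' + 2 * δ := by
  obtain ⟨N, hN⟩ := exists_nat_ge (2 * ‖f‖ / δ)
  have hb : ∀ x, |f x| ≤ ‖f‖ := fun x => f.norm_coe_le_norm x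
  -- `s x` measures the height of `f x` above `-‖f‖` in units of `δ`
  let s : S → ℝ := fun x => (f x + ‖f‖) / δ
  have hs : Continuous s := by fun_prop
  have hfs : ∀ x, f x = δ * s x - ‖f‖ := fun x => by simp only [s]; field_simp; ring
  have hs0 : ∀ x, 0 ≤ s x := fun x => div_nonneg (by linarith [(abs_le.1 (hb x)).1]) hδ.le
  have hsN : ∀ x, s x ≤ N := fun x => le_trans
    (div_le_div_of_nonneg_right (by linarith [(abs_le.1 (hb x)).2]) hδ.le) hN
  let K : ℕ → Set S := fun i => {x | (i + 1 : ℝ) ≤ s x}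
  have hK : ∀ i, IsClosed (K i) := fun i => isClosed_le continuous_const hs
  have hlev : ∀ᶠ n in atTop, ∀ i ∈ Finset.range N,
      P.real {ω | Z n ω ∈ K i} ≤ P'.real {ω | Y ω ∈ K i} + 1 / (N + 1) := by
    refine (Finset.eventually_all _).2 fun i _ => ?_
    have hlt : P' {ω | Y ω ∈ K i} < P' {ω | Y ω ∈ K i} + ENNReal.ofReal (1 / (N + 1)) :=
      ENNReal.lt_add_right (measure_ne_top _ _) (by simp; positivity)
    filter_upwards [eventually_lt_of_limsup_lt ((h _ (hK i)).trans_lt hlt)] with n hn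
    have := ENNReal.toReal_mono (by finiteness) hn.le
    rwa [ENNReal.toReal_add (by finiteness) (by finiteness),
      ENNReal.toReal_ofReal (by positivity)] at this
  filter_upwards [hlev] with n hn
  let B : ℕ → Set Ω := fun i => toMeasurable P {ω | Z n ω ∈ K i}
  have hB : ∀ i, MeasurableSet (B i) := fun i => measurableSet_toMeasurable _ _
  let u : Ω → ℝ := fun ω => δ * (∑ i ∈ Finset.range N, (B i).indicator 1 ω) + (δ - ‖f‖)
  have hBi : ∀ i, Integrable ((B i).indicator (1 : Ω → ℝ)) P := fun i =>
    (integrable_const (1 : ℝ)).indicator (hB i)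
  have hsi : Integrable (fun ω => ∑ i ∈ Finset.range N, (B i).indicator (1 : Ω → ℝ) ω) P :=
    integrable_finsetSum _ fun i _ => hBi i
  have hui : Integrable u P := (hsi.const_mul δ).add (integrable_const _)
  refine ⟨u, ?_, hui, fun ω => ?_, ?_⟩
  · exact ((Finset.measurable_sum _ fun i _ =>
      measurable_one.indicator (hB i)).const_mul δ).add_const _
  · have h1 : (∑ i ∈ Finset.range N, if (i + 1 : ℝ) ≤ s (Z n ω) then (1 : ℝ) else 0)
        ≤ ∑ i ∈ Finset.range N, (B i).indicator (1 : Ω → ℝ) ω := by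
      refine Finset.sum_le_sum fun i _ => ?_
      split_ifs with hi
      · have : ω ∈ B i := subset_toMeasurable P _ hi
        simp [this]
      · exact Set.indicator_nonneg (fun _ _ => zero_le_one) _
    have h2 := (sum_indicator_levels (hs0 (Z n ω)) (hsN _)).2
    rw [hfs]
    have := mul_le_mul_of_nonneg_left (h2.trans h1) hδ.le
    simp only [u]
    linarith
  · have hYi : Integrable (fun ω => f (Y ω)) P' :=
      Integrable.of_bound (f.continuous.measurable.comp_aemeasurable hY).aestronglyMeasurable ‖f‖
        (ae_of_all _ fun ω => f.norm_coe_le_norm _)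
    have hsY : Integrable (fun ω => s (Y ω)) P' := (hYi.add (integrable_const _)).div_const δ
    have hKm : ∀ i, NullMeasurableSet {ω | Y ω ∈ K i} P' := fun i =>
      hY.nullMeasurable (hK i).measurableSet
    have e1 : ∫ ω, u ω ∂P = δ * ∑ i ∈ Finset.range N, P.real {ω | Z n ω ∈ K i} + (δ - ‖f‖) := by
      simp only [u]
      rw [integral_add (hsi.const_mul δ) (integrable_const _), integral_const_mul,
        integral_finsetSum _ fun i _ => hBi i]
      simp [integral_indicator_one (hB _), B, measureReal_def, measure_toMeasurable]
    have e2 : ∑ i ∈ Finset.range N, P'.real {ω | Y ω ∈ K i} ≤ ∫ ω, s (Y ω) ∂P' := by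
      have hKi : ∀ i, Integrable ({ω | Y ω ∈ K i}.indicator (1 : Ω' → ℝ)) P' := fun i =>
        (integrable_const (1 : ℝ)).indicator₀ (hKm i)
      calc ∑ i ∈ Finset.range N, P'.real {ω | Y ω ∈ K i}
          = ∫ ω, ∑ i ∈ Finset.range N, {ω | Y ω ∈ K i}.indicator (1 : Ω' → ℝ) ω ∂P' := by
            rw [integral_finsetSum _ fun i _ => hKi i]
            refine Finset.sum_congr rfl fun i _ => ?_
            rw [integral_indicator₀ (hKm i)]
            simp
        _ ≤ ∫ ω, s (Y ω) ∂P' := by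
            refine integral_mono (integrable_finsetSum _ fun i _ => hKi i) hsY fun ω => ?_
            refine le_trans (le_of_eq ?_) (sum_indicator_levels (hs0 (Y ω)) (hsN _)).1
            exact Finset.sum_congr rfl fun i _ => by simp [Set.indicator_apply, K]
    have e3 : ∫ ω, f (Y ω) ∂P' = δ * ∫ ω, s (Y ω) ∂P' - ‖f‖ := by
      simp_rw [hfs]
      rw [integral_sub (hsY.const_mul δ) (integrable_const _), integral_const_mul]
      simp
    have e4 : ∑ i ∈ Finset.range N, P.real {ω | Z n ω ∈ K i}
        ≤ ∑ i ∈ Finset.range N, P'.real {ω | Y ω ∈ K i} + 1 := by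
      refine (Finset.sum_le_sum hn).trans ?_
      rw [Finset.sum_add_distrib]
      have : (N : ℝ) * (1 / (N + 1)) ≤ 1 := by
        rw [mul_one_div, div_le_one (by positivity)]; linarith
      simpa using this
    rw [e1, e3]
    have := mul_le_mul_of_nonneg_left (e4.trans (add_le_add_left e2 1)) hδ.le
    linarith

/-- The converse half of the portmanteau theorem: the closed-set inequality implies weak
convergence. The lower bound on the outer expectations comes from measurable minorants, that is,
from majorants of `-f (Z n)`. -/
lemma weakConv_of_limsup_measure_le [IsProbabilityMeasure P] (hY : AEMeasurable Y P')
    (h : ∀ K : Set S, IsClosed K →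
      limsup (fun n => P {ω | Z n ω ∈ K}) atTop ≤ P' {ω | Y ω ∈ K}) :
    WeakConv P P' Z Y := by
  refine ⟨hY, fun f => tendsto_order.2 ⟨fun a ha => ?_, fun a ha => ?_⟩⟩
  · obtain ⟨c, hac, hc⟩ := EReal.lt_iff_exists_real_btwn.1 ha
    have hc' : c < ∫ ω, f (Y ω) ∂P' := EReal.coe_lt_coe_iff.1 hc
    filter_upwards [eventually_exists_majorant hY h (-f)
      (δ := (∫ ω, f (Y ω) ∂P' - c) / 2) (by linarith)] with n ⟨u, _, hi, hu, hint⟩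
    have hm := integral_le_outerExpectation (T := fun ω => ((f (Z n ω) : ℝ) : EReal)) hi.neg
      fun ω => EReal.coe_le_coe_iff.2 (by
        have := hu ω
        simp only [BoundedContinuousFunction.coe_neg, Pi.neg_apply] at this ⊢
        linarith)
    refine hac.trans_le (le_trans (EReal.coe_le_coe_iff.2 ?_) hm)
    simp only [BoundedContinuousFunction.coe_neg, Pi.neg_apply, integral_neg] at hint ⊢
    linarith
  · obtain ⟨c, hc, hca⟩ := EReal.lt_iff_exists_real_btwn.1 ha
    have hc' : ∫ ω, f (Y ω) ∂P' < c := EReal.coe_lt_coe_iff.1 hc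
    filter_upwards [eventually_exists_majorant hY h f
      (δ := (c - ∫ ω, f (Y ω) ∂P') / 2) (by linarith)] with n ⟨u, hum, hi, hu, hint⟩
    refine lt_of_le_of_lt (le_trans (outerExpectation_le_integral hum hi
      fun ω => EReal.coe_le_coe_iff.2 (hu ω)) (EReal.coe_le_coe_iff.2 ?_)) hca
    linarith

end Portmanteau

/-! ### The extended continuous mapping theorem -/

section ExtendedContinuousMapping

variable {Ω Ω' D E : Type*} [MeasurableSpace Ω] [MeasurableSpace Ω']
  [TopologicalSpace D] [TopologicalSpace E]

/-- On sets `A` of probability arbitrarily close to `1`, the random maps `g n ω`, defined on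
`G n ω`, satisfy `g (k m) (w m) (h m) → g₀ h₀` along all subsequences `k`, all points `w m ∈ A` and
all `h m ∈ G (k m) (w m)` with `h m → h₀ ∈ D₁`. -/
def SubseqContinuousConv (P : Measure Ω) (G : ℕ → Ω → Set D) (g : ℕ → Ω → D → E) (D₁ : Set D)
    (g₀ : D → E) : Prop :=
  ∀ ε : ℝ, 0 < ε → ∃ A : Set Ω, MeasurableSet A ∧ 1 - ε ≤ P.real A ∧
    ∀ (k : ℕ → ℕ) (w : ℕ → Ω) (h : ℕ → D) (h₀ : D), StrictMono k → (∀ m, w m ∈ A) →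
      (∀ m, h m ∈ G (k m) (w m)) → h₀ ∈ D₁ → Tendsto h atTop (𝓝 h₀) →
        Tendsto (fun m => g (k m) (w m) (h m)) atTop (𝓝 (g₀ h₀))

/-- A point all of whose neighbourhoods meet infinitely many of the sets `S n` is the limit of a
sequence of points of `S (k m)` for some subsequence `k`. -/
lemma exists_seq_of_forall_nhds_frequently [FirstCountableTopology D] {S : ℕ → Set D} {x : D}
    (h : ∀ U ∈ 𝓝 x, ∃ᶠ n in atTop, (U ∩ S n).Nonempty) :
    ∃ (k : ℕ → ℕ) (y : ℕ → D), StrictMono k ∧ (∀ m, y m ∈ S (k m)) ∧ Tendsto y atTop (𝓝 x) := by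
  obtain ⟨u, hu⟩ := (𝓝 x).exists_antitone_basis
  obtain ⟨k, hk, hne⟩ := extraction_forall_of_frequently fun i => h (u i) (hu.mem i)
  choose y hy using hne
  exact ⟨k, y, hk, fun m => (hy m).2, hu.tendsto fun m => (hy m).1⟩

/-- The extended continuous mapping theorem, in the form of the closed-set inequality. Up to
probability `ε`, the event `g n ω (Z n ω) ∈ K` for `n ≥ j` forces `Z n ω` into the closure `L j` of
the set of all `h` that some `g n ω` with `n ≥ j`, `ω ∈ A` sends to `K`. The intersection of
the `L j` lies in `g₀ ⁻¹' K`, as far as points of `D₁` are concerned. -/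
lemma SubseqContinuousConv.limsup_measure_le [FirstCountableTopology D] [MeasurableSpace D]
    [OpensMeasurableSpace D] {P : Measure Ω} [IsProbabilityMeasure P] {P' : Measure Ω'}
    [IsProbabilityMeasure P'] {G : ℕ → Ω → Set D} {g : ℕ → Ω → D → E} {D₁ : Set D} {g₀ : D → E}
    (hg : SubseqContinuousConv P G g D₁ g₀) {Z : ℕ → Ω → D} {Y : Ω' → D}
    (hZ : ∀ n ω, Z n ω ∈ G n ω) (hY : AEMeasurable Y P') (hYD : ∀ᵐ ω ∂P', Y ω ∈ D₁)
    (hlim : ∀ K : Set D, IsClosed K →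
      limsup (fun n => P {ω | Z n ω ∈ K}) atTop ≤ P' {ω | Y ω ∈ K})
    {K : Set E} (hK : IsClosed K) :
    limsup (fun n => P {ω | g n ω (Z n ω) ∈ K}) atTop ≤ P' {ω | g₀ (Y ω) ∈ K} := by
  refine ENNReal.le_of_forall_pos_le_add fun ε hε _ => ?_
  obtain ⟨A, hA, hPA, hconv⟩ := hg ε hε
  have hAc : P Aᶜ ≤ ε := by
    have h1 : P.real Aᶜ ≤ ε := by rw [probReal_compl_eq_one_sub hA]; linarith
    rw [← ofReal_measureReal (by finiteness)]
    exact (ENNReal.ofReal_le_ofReal h1).trans_eq (ENNReal.ofReal_coe_nnreal)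
  let L : ℕ → Set D := fun j => closure {h | ∃ n ≥ j, ∃ ω ∈ A, h ∈ G n ω ∧ g n ω h ∈ K}
  have hLanti : Antitone L := fun i j hij => closure_mono
    fun h ⟨n, hn, hrest⟩ => ⟨n, le_trans hij hn, hrest⟩
  have hle : ∀ j, limsup (fun n => P {ω | g n ω (Z n ω) ∈ K}) atTop ≤ P' {ω | Y ω ∈ L j} + ε := by
    intro j
    calc limsup (fun n => P {ω | g n ω (Z n ω) ∈ K}) atTop
        ≤ limsup (fun n => P {ω | Z n ω ∈ L j} + ε) atTop := by
          refine limsup_le_limsup ?_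
          filter_upwards [eventually_ge_atTop j] with n hn
          refine le_trans (measure_mono (t := {ω | Z n ω ∈ L j} ∪ Aᶜ) fun ω hω => ?_)
            ((measure_union_le _ _).trans (by gcongr))
          by_cases hωA : ω ∈ A
          · exact Or.inl (subset_closure ⟨n, hn, ω, hωA, hZ n ω, hω⟩)
          · exact Or.inr hωA
      _ ≤ limsup (fun n => P {ω | Z n ω ∈ L j}) atTop + ε := by
          rw [limsup_add_const _ _ _ (by isBoundedDefault) (by isBoundedDefault)]
      _ ≤ P' {ω | Y ω ∈ L j} + ε := by gcongr; exact hlim _ isClosed_closure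
  have hL : Tendsto (fun j => P' {ω | Y ω ∈ L j}) atTop (𝓝 (P' (⋂ j, {ω | Y ω ∈ L j}))) :=
    tendsto_measure_iInter_atTop
      (fun j => hY.nullMeasurable (isClosed_closure.measurableSet))
      (fun i j hij ω hω => hLanti hij hω) ⟨0, by finiteness⟩
  refine (ge_of_tendsto' (hL.add_const (ε : ℝ≥0∞)) hle).trans ?_
  gcongr 1
  refine measure_mono_ae ?_
  filter_upwards [hYD] with ω hω hωL
  have hfreq : ∀ U ∈ 𝓝 (Y ω), ∃ᶠ n in atTop,
      (U ∩ {h | ∃ ω ∈ A, h ∈ G n ω ∧ g n ω h ∈ K}).Nonempty := fun U hU => by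
    refine frequently_atTop.2 fun j => ?_
    obtain ⟨h, hhU, n, hn, hh⟩ := mem_closure_iff_nhds.1 (Set.mem_iInter.1 hωL j) U hU
    exact ⟨n, hn, h, hhU, hh⟩
  obtain ⟨k, y, hk, hy, hylim⟩ := exists_seq_of_forall_nhds_frequently hfreq
  choose w hwA hwG hwK using hy
  exact hK.mem_of_tendsto (hconv k w y (Y ω) hk hwA hwG hω hylim) (Eventually.of_forall hwK)

/-- The limit of a continuously convergent sequence of maps is continuous at the points that are
limits of points of the domains: nearby values of `g₀` are nearby values of the `g n ω`. -/
lemma SubseqContinuousConv.continuousOn [FirstCountableTopology D] [RegularSpace E]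
    {P : Measure Ω} {G : ℕ → Ω → Set D} {g : ℕ → Ω → D → E} {D₁ : Set D} {g₀ : D → E}
    (hg : SubseqContinuousConv P G g D₁ g₀)
    (hD₁ : ∀ x ∈ D₁, ∃ h : ℕ → D, (∀ n ω, h n ∈ G n ω) ∧ Tendsto h atTop (𝓝 x)) :
    ContinuousOn g₀ D₁ := by
  obtain ⟨A, -, hPA, hconv⟩ := hg (1 / 2) (by norm_num)
  obtain ⟨ω₀, hω₀⟩ : A.Nonempty := by
    rw [Set.nonempty_iff_ne_empty]
    rintro rfl
    norm_num at hPA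
  -- the defining convergence along the full sequence
  have hfull : ∀ x ∈ D₁, ∀ h : ℕ → D, (∀ n ω, h n ∈ G n ω) → Tendsto h atTop (𝓝 x) →
      Tendsto (fun n => g n ω₀ (h n)) atTop (𝓝 (g₀ x)) := fun x hx h hG hlim =>
    hconv id (fun _ => ω₀) h x strictMono_id (fun _ => hω₀) (fun n => hG n ω₀) hx hlim
  intro x₀ hx₀
  refine ((closed_nhds_basis (g₀ x₀)).tendsto_right_iff).2 fun V ⟨hV, hVc⟩ => ?_
  by_contra hcon
  rw [not_eventually] at hcon
  have hfreq : ∀ U ∈ 𝓝 x₀, ∃ᶠ n in atTop, (U ∩ {h | h ∈ G n ω₀ ∧ g n ω₀ h ∉ V}).Nonempty := by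
    intro U hU
    obtain ⟨x, ⟨hxV, hxD⟩, hxU⟩ := ((hcon.and_eventually self_mem_nhdsWithin).and_eventually
      (mem_nhdsWithin_of_mem_nhds (eventually_mem_nhds_iff.2 hU))).exists
    obtain ⟨h, hG, hlim⟩ := hD₁ x hxD
    refine Eventually.frequently ?_
    filter_upwards [hlim.eventually_mem hxU,
      (hfull x hxD h hG hlim).eventually_mem (hVc.isOpen_compl.mem_nhds hxV)] with n h1 h2
    exact ⟨h n, h1, hG n ω₀, h2⟩
  obtain ⟨k, y, hk, hy, hylim⟩ := exists_seq_of_forall_nhds_frequently hfreq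
  obtain ⟨m, hm⟩ := ((hconv k (fun _ => ω₀) y x₀ hk (fun _ => hω₀) (fun m => (hy m).1) hx₀
    hylim).eventually_mem hV).exists
  exact (hy m).2 hm

/-- Composition with a map that is continuous on an arbitrary, possibly non-measurable set: the
measurable version of `Y` can be chosen to stay in that set. -/
lemma aemeasurable_comp_of_continuousOn [MeasurableSpace D] [BorelSpace D] [MeasurableSpace E]
    [BorelSpace E] {P' : Measure Ω'} [NeZero P'] {Y : Ω' → D} {D₁ : Set D} {g₀ : D → E}
    (hg : ContinuousOn g₀ D₁) (hY : AEMeasurable Y P') (hYD : ∀ᵐ ω ∂P', Y ω ∈ D₁) :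
    AEMeasurable (fun ω => g₀ (Y ω)) P' := by
  obtain ⟨ω₀, hω₀⟩ := hYD.exists
  obtain ⟨Y', hY'm, hY'D, hYY'⟩ := hY.exists_ae_eq_range_subset hYD ⟨Y ω₀, hω₀⟩
  have hmem : ∀ ω, Y' ω ∈ D₁ := fun ω => hY'D ⟨ω, rfl⟩
  refine ⟨fun ω => D₁.domRestrict g₀ ⟨Y' ω, hmem ω⟩, ?_, ?_⟩
  · exact hg.domRestrict.measurable.comp (hY'm.subtype_mk)
  · filter_upwards [hYY'] with ω hω
    simp [hω, Set.domRestrict]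

/-- The common conclusion of both parts. The statement on outer probability is the closed-set
inequality for `g n ω h - g₀ h`, which converges continuously to `0` if `g₀` is continuous. -/
lemma SubseqContinuousConv.weakConv_and_tendstoZero [TopologicalSpace.MetrizableSpace D]
    [MeasurableSpace D] [BorelSpace D] [AddCommGroup E] [IsTopologicalAddGroup E] [MeasurableSpace E]
    [BorelSpace E]
    {P : Measure Ω} [IsProbabilityMeasure P] {P' : Measure Ω'} [IsProbabilityMeasure P']
    {G : ℕ → Ω → Set D} {g : ℕ → Ω → D → E} {D₁ : Set D} {g₀ : D → E}
    (hg : SubseqContinuousConv P G g D₁ g₀) (hg₀ : ContinuousOn g₀ D₁)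
    {Z : ℕ → Ω → D} {Y : Ω' → D} (hZ : ∀ n ω, Z n ω ∈ G n ω) (hYD : ∀ᵐ ω ∂P', Y ω ∈ D₁)
    (hconv : WeakConv P P' Z Y) :
    WeakConv P P' (fun n ω => g n ω (Z n ω)) (fun ω => g₀ (Y ω)) ∧
      (Continuous g₀ → TendstoZeroInOuterProb P (fun n ω => g n ω (Z n ω) - g₀ (Z n ω))) := by
  have hlim := fun (K : Set D) (hK : IsClosed K) => hconv.limsup_measure_le hK
  refine ⟨weakConv_of_limsup_measure_le (aemeasurable_comp_of_continuousOn hg₀ hconv.1 hYD)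
    fun K hK => hg.limsup_measure_le hZ hconv.1 hYD hlim hK, fun hcont U hU => ?_⟩
  have hsub : SubseqContinuousConv P G (fun n ω h => g n ω h - g₀ h) D₁ (fun _ => 0) := by
    intro ε hε
    obtain ⟨A, hA, hPA, hA'⟩ := hg ε hε
    refine ⟨A, hA, hPA, fun k w h h₀ hk hw hh hh₀ hlim => ?_⟩
    simpa using (hA' k w h h₀ hk hw hh hh₀ hlim).sub ((hcont.tendsto h₀).comp hlim)
  have h0 := hsub.limsup_measure_le hZ hconv.1 hYD hlim (isOpen_interior (s := U)).isClosed_compl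
  have hmem : (0 : E) ∈ interior U := mem_interior_iff_mem_nhds.2 hU
  simp only [Set.mem_compl_iff, hmem, not_true_eq_false, Set.ofPred_false, measure_empty] at h0
  have h1 : Tendsto (fun n => P {ω | g n ω (Z n ω) - g₀ (Z n ω) ∉ interior U}) atTop (𝓝 0) :=
    tendsto_of_le_liminf_of_limsup_le bot_le h0
  exact tendsto_of_tendsto_of_tendsto_of_le_of_le tendsto_const_nhds h1 (fun _ => zero_le)
    fun n => measure_mono fun ω hω h => hω (interior_subset h)

end ExtendedContinuousMapping

/-! ### Lower limits of sets and the support of a weak limit -/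

section LimitSet

variable {Ω Ω' D : Type*} [MeasurableSpace Ω] [MeasurableSpace Ω'] [TopologicalSpace D]

/-- The lower limit of a sequence of sets: the points all of whose neighbourhoods meet `S n` for
all large `n`. -/
def lowerLimit (S : ℕ → Set D) : Set D :=
  {x | ∀ U ∈ 𝓝 x, ∀ᶠ n in atTop, (U ∩ S n).Nonempty}

lemma exists_seq_of_mem_lowerLimit [TopologicalSpace.PseudoMetrizableSpace D] {S : ℕ → Set D}
    (hS : ∀ n, (S n).Nonempty) {x : D} (hx : x ∈ lowerLimit S) :
    ∃ h : ℕ → D, (∀ n, h n ∈ S n) ∧ Tendsto h atTop (𝓝 x) := by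
  let := TopologicalSpace.pseudoMetrizableSpacePseudoMetric D
  have hex : ∀ n : ℕ, ∃ y ∈ S n, dist x y < Metric.infDist x (S n) + 1 / ((n : ℝ) + 1) := fun n =>
    (Metric.infDist_lt_iff (hS n)).1 (lt_add_of_pos_right _ Nat.one_div_pos_of_nat)
  choose h hhS hh using hex
  refine ⟨h, hhS, Metric.tendsto_atTop'.2 fun ε hε => ?_⟩
  have h1 := hx _ (Metric.ball_mem_nhds x (half_pos hε))
  have h2 := (tendsto_one_div_add_atTop_nhds_zero_nat (𝕜 := ℝ)).eventually_lt_const (half_pos hε)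
  obtain ⟨N, hN⟩ := eventually_atTop.1 (h1.and h2)
  refine ⟨N, fun n hn => ?_⟩
  obtain ⟨⟨y, hy, hyS⟩, hn2⟩ := hN n hn.le
  have h3 : Metric.infDist x (S n) ≤ dist x y := Metric.infDist_le_dist_of_mem hyS
  rw [Metric.mem_ball, dist_comm] at hy
  rw [dist_comm]
  linarith [hh n]

/-- A separable weak limit of maps with values in `S n` lies almost surely in the lower limit of
the sets `S n`: every other point has a neighbourhood that infinitely many `S n` avoid, and that is
therefore negligible; countably many of these suffice. -/
lemma ae_mem_lowerLimit [TopologicalSpace.PseudoMetrizableSpace D] [MeasurableSpace D]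
    [BorelSpace D] {P : Measure Ω} [IsProbabilityMeasure P] {P' : Measure Ω'}
    [IsProbabilityMeasure P'] {Z : ℕ → Ω → D} {Y : Ω' → D} {S : ℕ → Set D}
    (hZ : ∀ n ω, Z n ω ∈ S n) (hY : AEMeasurable Y P') (hsep : IsSeparableElement P' Y)
    (hlim : ∀ K : Set D, IsClosed K →
      limsup (fun n => P {ω | Z n ω ∈ K}) atTop ≤ P' {ω | Y ω ∈ K}) :
    ∀ᵐ ω ∂P', Y ω ∈ lowerLimit S := by
  obtain ⟨C, hC, -, hYC⟩ := hsep
  have hnull : ∀ x ∉ lowerLimit S, ∃ U ∈ 𝓝 x, P' {ω | Y ω ∈ U} = 0 := by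
    intro x hx
    simp only [lowerLimit, Set.mem_ofPred_eq, not_forall, not_eventually] at hx
    obtain ⟨V, hV, hfreq⟩ := hx
    refine ⟨interior V, interior_mem_nhds.2 hV, ?_⟩
    have h1 : (1 : ℝ≥0∞) ≤ limsup (fun n => P {ω | Z n ω ∈ (interior V)ᶜ}) atTop := by
      refine le_limsup_of_frequently_le (hfreq.mono fun n hn => ?_) (by isBoundedDefault)
      have : {ω | Z n ω ∈ (interior V)ᶜ} = Set.univ := Set.eq_univ_of_forall fun ω hω =>
        hn ⟨Z n ω, interior_subset hω, hZ n ω⟩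
      rw [this, measure_univ]
    have h2 := h1.trans (hlim _ isOpen_interior.isClosed_compl)
    have h3 : NullMeasurableSet {ω | Y ω ∈ interior V} P' :=
      hY.nullMeasurable isOpen_interior.measurableSet
    exact (prob_compl_eq_one_iff₀ h3).1 (le_antisymm prob_le_one h2)
  choose! U hU hU0 using hnull
  have hsepC : TopologicalSpace.IsSeparable (C \ lowerLimit S) := hC.mono Set.sdiff_subset
  have := hsepC.secondCountableTopology
  have hLind : IsLindelof (C \ lowerLimit S) := IsLindelof.of_coe
  obtain ⟨t, htc, ht, hcov⟩ := hLind.elim_nhds_subcover U fun x hx => hU x hx.2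
  have hae : ∀ᵐ ω ∂P', ∀ x ∈ t, Y ω ∉ U x :=
    (ae_ball_iff htc).2 fun x hx => by
      simpa [ae_iff] using hU0 x (ht x hx).2
  filter_upwards [hae, hYC] with ω h1 h2
  by_contra h3
  obtain ⟨x, hx, hxU⟩ := Set.mem_iUnion₂.1 (hcov ⟨h2, h3⟩)
  exact h1 x hx hxU

end LimitSet

/-! ### Random difference quotients -/

section DifferenceQuotient

variable {Ω D E : Type*} [AddCommGroup D] [Module ℝ D] [AddCommGroup E] [Module ℝ E]

/-- The domain of the `n`-th difference quotient at `ω`. -/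
def quotDomain (DF : Set D) (r : ℕ → ℝ) (φ : ℕ → Ω → D) (n : ℕ) (ω : Ω) : Set D :=
  {h | φ n ω + (r n)⁻¹ • h ∈ DF}

/-- The directions admissible for the `n`-th difference quotient at every `ω`. -/
def commonDomain (DF : Set D) (r : ℕ → ℝ) (φ : ℕ → Ω → D) (n : ℕ) : Set D :=
  {h | ∀ ω, φ n ω + (r n)⁻¹ • h ∈ DF}

lemma diffQuot_smul_sub (F : D → E) (r : ℕ → ℝ) (φ X : ℕ → Ω → D) (n : ℕ) (ω : Ω) :
    diffQuot F r φ n ω (r n • (X n ω - φ n ω)) = r n • (F (X n ω) - F (φ n ω)) := by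
  unfold diffQuot
  rcases eq_or_ne (r n) 0 with h | h
  · simp [h]
  · rw [inv_smul_smul₀ h, add_sub_cancel]

/-- The translation condition puts `r n • (X n ω - φ n ω)` into the common domain. If `r n = 0`,
this holds because `φ n` takes its values in `DF`. -/
lemma smul_sub_mem_commonDomain {DF : Set D} {r : ℕ → ℝ} {φ X : ℕ → Ω → D}
    (hφ : ∀ n ω, φ n ω ∈ DF) (hXφ : ∀ n ω ω', X n ω - φ n ω + φ n ω' ∈ DF) (n : ℕ) (ω : Ω) :
    r n • (X n ω - φ n ω) ∈ commonDomain DF r φ n := by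
  intro ω'
  rcases eq_or_ne (r n) 0 with h | h
  · simpa [h] using hφ n ω'
  · rw [inv_smul_smul₀ h, add_comm]
    exact hXφ n ω ω'

lemma smul_sub_mem_quotDomain {DF : Set D} {r : ℕ → ℝ} {φ X : ℕ → Ω → D}
    (hφ : ∀ n ω, φ n ω ∈ DF) (hX : ∀ n ω, X n ω ∈ DF) (n : ℕ) (ω : Ω) :
    r n • (X n ω - φ n ω) ∈ quotDomain DF r φ n ω := by
  rcases eq_or_ne (r n) 0 with h | h
  · simpa [quotDomain, h] using hφ n ω
  · simpa [quotDomain, inv_smul_smul₀ h] using hX n ω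

variable [MeasurableSpace Ω] [TopologicalSpace D] [TopologicalSpace E]

/-- The uniform condition passes to subsequences, once the limit points are restricted to the lower
limit of the common domains: there a sequence given along a subsequence can be completed to a full
one with the same limit. -/
lemma UniformCondition.subseqContinuousConv [TopologicalSpace.PseudoMetrizableSpace D]
    {P : Measure Ω} {F : D → E} {DF D0 : Set D} {r : ℕ → ℝ} {φ : ℕ → Ω → D} {F' : D → E}
    (h : UniformCondition P F DF D0 r φ F') (hne : ∀ n, (commonDomain DF r φ n).Nonempty) :
    SubseqContinuousConv P (fun n _ => commonDomain DF r φ n) (diffQuot F r φ)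
      (D0 ∩ lowerLimit (commonDomain DF r φ)) F' := by
  intro ε hε
  obtain ⟨A, hA, hPA, hconv⟩ := h ε hε
  refine ⟨A, hA, hPA, fun k w h h₀ hk hw hh hh₀ hlim => ?_⟩
  obtain ⟨y, hy, hylim⟩ := exists_seq_of_mem_lowerLimit hne hh₀.2
  -- `h m` in place `k m`, and `y n` in the places `n` that `k` omits
  let z : ℕ → D := Function.extend k h y
  have hzk : ∀ m, z (k m) = h m := fun m => hk.injective.extend_apply h y m
  have hz : ∀ n, z n ∈ commonDomain DF r φ n ∧ (z n = y n ∨ ∃ m, k m = n ∧ z n = h m) := by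
    intro n
    by_cases hn : ∃ m, k m = n
    · obtain ⟨m, rfl⟩ := hn
      rw [hzk]
      exact ⟨hh m, Or.inr ⟨m, rfl, rfl⟩⟩
    · have : z n = y n := Function.extend_apply' _ _ _ hn
      rw [this]
      exact ⟨hy n, Or.inl rfl⟩
  have hzlim : Tendsto z atTop (𝓝 h₀) := by
    refine tendsto_def.2 fun U hU => ?_
    obtain ⟨M, hM⟩ := eventually_atTop.1 (hlim.eventually_mem hU)
    filter_upwards [hylim.eventually_mem hU, eventually_ge_atTop (k M)] with n hn hnM
    rcases (hz n).2 with h1 | ⟨m, rfl, h1⟩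
    · simpa [h1] using hn
    · simpa [h1] using hM m (hk.le_iff_le.1 hnM)
  refine tendsto_def.2 fun V hV => ?_
  have := hk.tendsto_atTop.eventually
    (hconv z h₀ (fun n ω => (hz n).1 ω) hh₀.1 hzlim V hV)
  filter_upwards [this] with m hm
  simpa [hzk] using hm (w m) (hw m)

end DifferenceQuotient

end ExtendedDelta

/-! ### The extended delta method -/

theorem mainTheorem3
    {Ω Ω' D E : Type*}
    [MeasurableSpace Ω] (P : Measure Ω) [IsProbabilityMeasure P]
    [MeasurableSpace Ω'] (P' : Measure Ω') [IsProbabilityMeasure P']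
    [AddCommGroup D] [Module ℝ D] [TopologicalSpace D] [IsTopologicalAddGroup D]
    [ContinuousSMul ℝ D] [TopologicalSpace.MetrizableSpace D] [MeasurableSpace D] [BorelSpace D]
    [AddCommGroup E] [Module ℝ E] [TopologicalSpace E] [IsTopologicalAddGroup E]
    [ContinuousSMul ℝ E] [TopologicalSpace.MetrizableSpace E] [MeasurableSpace E] [BorelSpace E]
    (r : ℕ → ℝ) (hr : Tendsto r atTop atTop)
    (DF D0 : Set D) (F F' : D → E)
    (φ : ℕ → Ω → D) (hφ : ∀ n ω, φ n ω ∈ DF)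
    (X : ℕ → Ω → D) (hX : ∀ n ω, X n ω ∈ DF)
    (Y : Ω' → D) (hY : ∀ ω, Y ω ∈ D0)
    (hconv : ExtendedDelta.WeakConv P P' (fun n ω => r n • (X n ω - φ n ω)) Y) :
    (ExtendedDelta.UniformCondition P F DF D0 r φ F' →
      (∀ n ω ω', X n ω - φ n ω + φ n ω' ∈ DF) →
      ExtendedDelta.IsSeparableElement P' Y →
        ExtendedDelta.WeakConv P P' (fun n ω => r n • (F (X n ω) - F (φ n ω)))
            (fun ω => F' (Y ω)) ∧
          (Continuous F' →
            ExtendedDelta.TendstoZeroInOuterProb P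
              (fun n ω => r n • (F (X n ω) - F (φ n ω)) - F' (r n • (X n ω - φ n ω))))) ∧
    (ExtendedDelta.SubseqCondition P F DF D0 r φ F' →
      ContinuousOn F' D0 →
        ExtendedDelta.WeakConv P P' (fun n ω => r n • (F (X n ω) - F (φ n ω)))
            (fun ω => F' (Y ω)) ∧
          (Continuous F' →
            ExtendedDelta.TendstoZeroInOuterProb P
              (fun n ω => r n • (F (X n ω) - F (φ n ω)) - F' (r n • (X n ω - φ n ω))))) := by
  simp only [← ExtendedDelta.diffQuot_smul_sub]
  refine ⟨fun hunif hXφ hsep => ?_, fun hsub hcont => ?_⟩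
  · have hZ := ExtendedDelta.smul_sub_mem_commonDomain (r := r) hφ hXφ
    have hne : ∀ n, (ExtendedDelta.commonDomain DF r φ n).Nonempty := fun n =>
      have ⟨ω⟩ := nonempty_of_isProbabilityMeasure P
      ⟨_, hZ n ω⟩
    have hconv' := hunif.subseqContinuousConv hne
    have hYlim : ∀ᵐ ω ∂P', Y ω ∈ D0 ∩ ExtendedDelta.lowerLimit
        (ExtendedDelta.commonDomain DF r φ) := by
      filter_upwards [ExtendedDelta.ae_mem_lowerLimit hZ hconv.1 hsep
        fun K hK => hconv.limsup_measure_le hK] with ω hω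
      exact ⟨hY ω, hω⟩
    refine hconv'.weakConv_and_tendstoZero (hconv'.continuousOn fun x hx => ?_) hZ hYlim hconv
    obtain ⟨h, hh, hlim⟩ := ExtendedDelta.exists_seq_of_mem_lowerLimit hne hx.2
    exact ⟨h, fun n _ => hh n, hlim⟩
  · have hconv' : ExtendedDelta.SubseqContinuousConv P (ExtendedDelta.quotDomain DF r φ)
        (ExtendedDelta.diffQuot F r φ) D0 F' := hsub
    exact hconv'.weakConv_and_tendstoZero hcont
      (ExtendedDelta.smul_sub_mem_quotDomain hφ hX) (ae_of_all _ hY) hconv
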